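/- All graphs are finite and simple. For a graph $G=(V,E)$, a set $S\subseteq V$ and an integer $k\ge 0$, let $P^0(S)=N[S]$ be the closed neighborhood of $S$, and for $i\ge 0$ let $P^{i+1}(S)=\bigcup\{N[v] : v\in P^i(S),\ |N[v]\setminus P^i(S)|\le k\}$. These sets increase with $i$; let $P^\infty(S)$ be their eventual value. The set $S$ is a $k$-power dominating set if $P^\infty(S)=V$, and the $k$-power domination number $\gamma_{p,k}(G)$ is the minimum cardinality of a $k$-power dominating set of $G$. A graph is claw-free if it has no induced subgraph isomorphic to $K_{1,3}$. For $k\ge l\ge 1$ let $A_l$ be the graph obtained from the complete graph $K_{k+l+2}$ by removing $l$ edges that share a common vertex $z$. For $t\ge 1$ let $C_{k,t}$ be the graph obtained from $t$ disjoint copies $C_1,\dots,C_t$ of $A_l$ by joining, for each $i$ (indices modulo $t$), the vertex $z$ of $C_i$ by $l$ edges to the $l$ vertices of $C_{i+1}$ that lost an edge (for $t=1$ this restores the removed edges, so $C_{k,1}=K_{k+l+2}$). Theorem. Let $l\in\{2,3\}$ and $k\ge l$. If $G$ is a connected claw-free $(k+l+1)$-regular graph of order $n$, then $$\gamma_{p,k}(G)\le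 \frac{n}{k+l+2}.$$ The bound is tight: for every $t\ge 1$, the graph $C_{k,t}$ is connected, claw-free and $(k+l+1)$-regular, has order $n=t(k+l+2)$, and satisfies $\gamma_{p,k}(C_{k,t})=\frac{n}{k+l+2}=t$. -/

import Mathlib

namespace SimpleGraph

/-- A graph is claw-free if the claw `K_{1,3}` is not isomorphic to an induced subgraph of it. -/
def IsClawFree {V : Type*} (G : SimpleGraph V) : Prop :=
  ¬ completeBipartiteGraph (Fin 1) (Fin 3) ⊴ G

/-- The closed neighborhood `N[v]` of a vertex. -/
def closedNbhd {V : Type*} (G : SimpleGraph V) (v : V) : Set V :=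
  insert v (G.neighborSet v)

/-- The set `P^i(S)` of vertices monitored by `S` at step `i`:
`P^0(S) = N[S]`, and `P^{i+1}(S)` is the union of all `N[v]` with `v ∈ P^i(S)` and
`|N[v] \ P^i(S)| ≤ k`. -/
def monitored {V : Type*} (G : SimpleGraph V) (k : ℕ) (S : Set V) : ℕ → Set V
  | 0 => ⋃ v ∈ S, G.closedNbhd v
  | i + 1 => ⋃ v ∈ {v | v ∈ monitored G k S i ∧
      (G.closedNbhd v \ monitored G k S i).encard ≤ (k : ℕ∞)}, G.closedNbhd v

/-- The set `P^∞(S)`. The sets `P^i(S)` increase with `i`, so it is the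
common value of the `P^i(S)` from the step on where they stabilize; see
`monitoredLimit_eq_of_stable`. -/
def monitoredLimit {V : Type*} (G : SimpleGraph V) (k : ℕ) (S : Set V) : Set V :=
  ⋃ i, G.monitored k S i

theorem monitored_subset_succ {V : Type*} (G : SimpleGraph V) (k : ℕ) (S : Set V) (i : ℕ) :
    G.monitored k S i ⊆ G.monitored k S (i + 1) := by
  have key : ∀ v, G.closedNbhd v ⊆ G.monitored k S i →
      G.closedNbhd v ⊆ G.monitored k S (i + 1) := by
    intro v hv
    have h0 : (G.closedNbhd v \ G.monitored k S i).encard ≤ (k : ℕ∞) := by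
      rw [Set.sdiff_eq_empty.mpr hv]; simp
    rw [monitored]
    exact Set.subset_biUnion_of_mem (u := fun v => G.closedNbhd v)
      (show v ∈ {v | v ∈ G.monitored k S i ∧ _} from ⟨hv (Set.mem_insert _ _), h0⟩)
  intro w hw
  cases i with
  | zero =>
    rw [monitored] at hw
    obtain ⟨v, hv, hwv⟩ := Set.mem_iUnion₂.mp hw
    refine key v ?_ hwv
    rw [monitored]
    exact Set.subset_biUnion_of_mem (u := fun v => G.closedNbhd v) hv
  | succ i =>
    rw [monitored] at hw
    obtain ⟨v, hv, hwv⟩ := Set.mem_iUnion₂.mp hw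
    refine key v ?_ hwv
    conv_rhs => rw [monitored]
    exact Set.subset_biUnion_of_mem (u := fun v => G.closedNbhd v) hv

theorem monitoredLimit_eq_of_stable {V : Type*} (G : SimpleGraph V) (k : ℕ) (S : Set V) (i : ℕ)
    (h : G.monitored k S i = G.monitored k S (i + 1)) :
    G.monitoredLimit k S = G.monitored k S i := by
  have hmono : Monotone (G.monitored k S) :=
    monotone_nat_of_le_succ (G.monitored_subset_succ k S)
  have hst : ∀ j, G.monitored k S (i + j) = G.monitored k S i := by
    intro j
    induction j with
    | zero => rfl
    | succ j ih =>
      rw [← add_assoc, monitored, ih, h]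
      conv_rhs => rw [monitored]
      rw [h]
  apply Set.Subset.antisymm
  · refine Set.iUnion_subset fun j => ?_
    rw [← hst j]
    exact hmono (Nat.le_add_left j i)
  · exact Set.subset_iUnion (G.monitored k S) i

/-- `S` is a `k`-power dominating set if `P^∞(S) = V`. -/
def IsPowerDominating {V : Type*} (G : SimpleGraph V) (k : ℕ) (S : Set V) : Prop :=
  G.monitoredLimit k S = Set.univ

/-- The `k`-power domination number: the minimum cardinality of a `k`-power dominating set.
In a finite graph the minimum exists, because the whole vertex set is power dominating. -/
noncomputable def powerDominationNumber {V : Type*} (G : SimpleGraph V) (k : ℕ) : ℕ :=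
  sInf {m : ℕ | ∃ S : Finset V, G.IsPowerDominating k (S : Set V) ∧ S.card = m}

theorem isPowerDominating_univ {V : Type*} (G : SimpleGraph V) (k : ℕ) :
    G.IsPowerDominating k Set.univ := by
  refine Set.eq_univ_of_forall fun v => Set.mem_iUnion.mpr ⟨0, ?_⟩
  rw [monitored]
  exact Set.mem_iUnion₂.mpr ⟨v, Set.mem_univ v, Set.mem_insert _ _⟩

/-- `A_j`: the complete graph on the `k + j + 2` vertices `0, …, k + j + 1` with the `j` edges
from the vertex `0` to the vertices `1, …, j` removed. -/
def graphA (k j : ℕ) : SimpleGraph (Fin (k + j + 2)) :=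
  (⊤ : SimpleGraph (Fin (k + j + 2))).deleteEdges
    {e | ∃ b : Fin (k + j + 2), 1 ≤ (b : ℕ) ∧ (b : ℕ) ≤ j ∧ e = s(0, b)}

/-- An edge linking the copy `p.1` of `A_l` to the cyclically next copy: it joins the vertex `0`
of the copy `p.1` (the vertex that lost `l` edges) to one of the vertices `1, …, l` (those that
lost one edge) of the copy `p.1 + 1`, where the copies are numbered modulo `t`. -/
def chainLink (k l t : ℕ) (p q : Fin t × Fin (k + l + 2)) : Prop :=
  (q.1 : ℕ) = ((p.1 : ℕ) + 1) % t ∧ (p.2 : ℕ) = 0 ∧ 1 ≤ (q.2 : ℕ) ∧ (q.2 : ℕ) ≤ l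

/-- The cyclic chain `C_{k,t}`: `t` disjoint copies of `A_l`, each one linked to the cyclically
next one by `l` edges. -/
def cyclicChain (k l t : ℕ) : SimpleGraph (Fin t × Fin (k + l + 2)) where
  Adj p q := (p.1 = q.1 ∧ (graphA k l).Adj p.2 q.2) ∨ chainLink k l t p q ∨ chainLink k l t q p
  symm := ⟨by
    rintro p q (⟨h1, h2⟩ | h | h)
    · exact Or.inl ⟨h1.symm, h2.symm⟩
    · exact Or.inr (Or.inr h)
    · exact Or.inr (Or.inl h)⟩
  loopless := ⟨by
    rintro p (⟨_, h⟩ | ⟨_, h0, h1, _⟩ | ⟨_, h0, h1, _⟩)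
    · exact h.ne rfl
    · omega
    · omega⟩

noncomputable instance (k l t : ℕ) : DecidableRel (cyclicChain k l t).Adj :=
  Classical.decRel _

end SimpleGraph

/-!
Write `d + 1 = k + l + 2` for the size of a closed neighborhood and `M = P^∞(S)`, the least
`k`-closed set containing `N[S]`. The upper bound comes from a greedy choice in which every chosen
vertex accounts for at least `d + 1` monitored vertices.

If `v ∈ M` has a neighbor outside `M`, then its unmonitored neighbors number at least `k + 1`
because `M` is closed, and form a clique `K` because `G` is claw-free
(`isClique_neighborSet_sdiff_monitoredLimit`). Once one vertex of `K` is chosen, all vertices of `K`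
propagate. The greedy choice can get stuck at a vertex `u` whose choice alone monitors everything at
distance at most two from `u`; such a vertex is called expansive here. The remedy is to begin with a
largest family of expansive vertices with disjoint closed neighborhoods, after which every
expansive vertex is monitored (`exists_expansive_packing`).

Suppose then that choosing any unmonitored vertex gains at most `d` vertices
(`exists_gain` refutes this). A vertex `q` of a clique `K` as above is not expansive, so it has an
unmonitored neighbor `y` that lies in a second clique `K'` of the same kind, disjoint from `K`
(`exists_adj_disjoint_of_not_isExpansive`). If choosing a vertex of `K` made `y` or the
monitored vertex behind `K'` propagate, it would gain `|K ∪ K'| ≥ 2k + 2 ≥ d + 1`. Hence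
`|K'| ≥ k + 2`, and `y` has at most `l - 1` neighbors in `K`. Taking `K` of largest size, so that
`|K| ≥ k + 2` too, there are at most `d - |K| ≤ l - 1` vertices `y`, whence
`|K| ≤ (l - 1) (d - |K|)`; for `l = 2` and `l = 3` this contradicts `k ≥ l`.

In the cyclic chain every closed neighborhood has one vertex for each label of `A_l`
(`cyclicChain_adj`), and a power dominating set has to meet each copy
(`exists_mem_of_isPowerDominating`).
-/

namespace SimpleGraph

/-! ### Closed sets of the propagation process -/

/-- A set `M` of vertices is `k`-closed if no vertex of `M` can propagate any further: each one
either has its whole closed neighborhood in `M` or misses more than `k` vertices of it.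
The set `P^∞(S)` is the least `k`-closed set that contains `N[S]`. -/
def IsPropagationClosed {V : Type*} (G : SimpleGraph V) (k : ℕ) (M : Set V) : Prop :=
  ∀ v ∈ M, (G.closedNbhd v \ M).encard ≤ (k : ℕ∞) → G.closedNbhd v ⊆ M

section Closed

variable {V : Type*} {G : SimpleGraph V} {k : ℕ}

theorem mem_closedNbhd_iff {v w : V} : w ∈ G.closedNbhd v ↔ w = v ∨ G.Adj v w := Iff.rfl

theorem self_mem_closedNbhd (v : V) : v ∈ G.closedNbhd v := Set.mem_insert _ _

theorem mem_closedNbhd_comm {v w : V} : w ∈ G.closedNbhd v ↔ v ∈ G.closedNbhd w := by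
  rw [mem_closedNbhd_iff, mem_closedNbhd_iff, eq_comm, G.adj_comm]

theorem closedNbhd_subset_monitoredLimit {S : Set V} {v : V} (hv : v ∈ S) :
    G.closedNbhd v ⊆ G.monitoredLimit k S := by
  intro w hw
  refine Set.mem_iUnion.mpr ⟨0, ?_⟩
  rw [monitored]
  exact Set.mem_iUnion₂.mpr ⟨v, hv, hw⟩

theorem subset_monitoredLimit (S : Set V) : S ⊆ G.monitoredLimit k S :=
  fun v hv => closedNbhd_subset_monitoredLimit hv (self_mem_closedNbhd v)

theorem monitoredLimit_subset {S M : Set V} (hM : G.IsPropagationClosed k M)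
    (hS : ∀ v ∈ S, G.closedNbhd v ⊆ M) : G.monitoredLimit k S ⊆ M := by
  refine Set.iUnion_subset fun i => ?_
  induction i with
  | zero =>
    rw [monitored]
    exact Set.iUnion₂_subset hS
  | succ i ih =>
    rw [monitored]
    refine Set.iUnion₂_subset ?_
    rintro v ⟨hv, hle⟩
    exact hM v (ih hv) ((Set.encard_le_encard (Set.sdiff_subset_sdiff_right ih)).trans hle)

theorem exists_monitoredLimit_eq [Finite V] (S : Set V) :
    ∃ i, G.monitoredLimit k S = G.monitored k S i ∧
      G.monitored k S i = G.monitored k S (i + 1) := by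
  obtain ⟨i, hi⟩ := WellFoundedGT.monotone_chain_condition
    ⟨G.monitored k S, monotone_nat_of_le_succ (G.monitored_subset_succ k S)⟩
  have h : G.monitored k S i = G.monitored k S (i + 1) := hi (i + 1) (Nat.le_succ i)
  exact ⟨i, G.monitoredLimit_eq_of_stable k S i h, h⟩

theorem isPropagationClosed_monitoredLimit [Finite V] (S : Set V) :
    G.IsPropagationClosed k (G.monitoredLimit k S) := by
  obtain ⟨i, hi, hst⟩ := exists_monitoredLimit_eq (G := G) (k := k) S
  rw [hi]
  intro v hv hle
  rw [hst, monitored]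
  exact Set.subset_biUnion_of_mem (u := fun v => G.closedNbhd v)
    (show v ∈ {v | v ∈ G.monitored k S i ∧ _} from ⟨hv, hle⟩)

theorem monitoredLimit_mono [Finite V] {S T : Set V} (h : S ⊆ T) :
    G.monitoredLimit k S ⊆ G.monitoredLimit k T :=
  monitoredLimit_subset (isPropagationClosed_monitoredLimit T)
    fun _ hv => closedNbhd_subset_monitoredLimit (h hv)

theorem exists_closedNbhd_subset_monitoredLimit {S : Set V} {v : V}
    (hv : v ∈ G.monitoredLimit k S) :
    ∃ w, v ∈ G.closedNbhd w ∧ G.closedNbhd w ⊆ G.monitoredLimit k S := by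
  obtain ⟨i, hi⟩ := Set.mem_iUnion.mp hv
  -- The sets `P^i(S)` are unions of closed neighborhoods at every step, including step `0`.
  cases i with
  | zero =>
    rw [monitored] at hi
    obtain ⟨w, hw, hvw⟩ := Set.mem_iUnion₂.mp hi
    exact ⟨w, hvw, closedNbhd_subset_monitoredLimit hw⟩
  | succ i =>
    rw [monitored] at hi
    obtain ⟨w, hw, hvw⟩ := Set.mem_iUnion₂.mp hi
    refine ⟨w, hvw, ?_⟩
    refine subset_trans ?_ (Set.subset_iUnion (G.monitored k S) (i + 1))
    conv_rhs => rw [monitored]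
    exact Set.subset_biUnion_of_mem (u := fun v => G.closedNbhd v) hw

theorem powerDominationNumber_le {S : Finset V} (h : G.IsPowerDominating k (S : Set V)) :
    G.powerDominationNumber k ≤ S.card :=
  Nat.sInf_le ⟨S, h, rfl⟩

theorem isClawFree_iff : G.IsClawFree ↔ ∀ v a b c, G.Adj v a → G.Adj v b → G.Adj v c →
    a ≠ b → a ≠ c → b ≠ c → G.Adj a b ∨ G.Adj a c ∨ G.Adj b c := by
  constructor
  · intro h v a b c ha hb hc hab hac hbc
    by_contra! hn
    obtain ⟨h1, h2, h3⟩ := hn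
    have hadj : ∀ x y, G.Adj (Sum.elim (fun _ => v) ![a, b, c] x)
        (Sum.elim (fun _ => v) ![a, b, c] y) ↔
          (completeBipartiteGraph (Fin 1) (Fin 3)).Adj x y := by
      rintro (x | x) (y | y) <;> fin_cases x <;> fin_cases y <;>
        simp [ha, hb, hc, h1, h2, h3, ha.symm, hb.symm, hc.symm, G.adj_comm b a, G.adj_comm c a,
          G.adj_comm c b]
    refine h ⟨⟨⟨Sum.elim (fun _ => v) ![a, b, c], ?_⟩, fun {x y} => hadj x y⟩⟩
    rintro (x | x) (y | y) hxy <;> fin_cases x <;> fin_cases y <;>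
      simp_all [ha.ne, hb.ne, hc.ne, ha.ne', hb.ne', hc.ne', hab.symm, hac.symm, hbc.symm]
  · rintro h ⟨f⟩
    have hadj : ∀ i : Fin 3, G.Adj (f (Sum.inl 0)) (f (Sum.inr i)) := fun i => by simp
    have hne : ∀ i j : Fin 3, i ≠ j → f (Sum.inr i) ≠ f (Sum.inr j) := fun i j hij h => by
      simpa [hij] using f.injective h
    have hna : ∀ i j : Fin 3, ¬ G.Adj (f (Sum.inr i)) (f (Sum.inr j)) := fun i j => by simp
    rcases h _ _ _ _ (hadj 0) (hadj 1) (hadj 2) (hne 0 1 (by decide)) (hne 0 2 (by decide))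
      (hne 1 2 (by decide)) with h | h | h
    exacts [hna _ _ h, hna _ _ h, hna _ _ h]

theorem IsPropagationClosed.closedNbhd_subset [Finite V] {M : Set V}
    (hM : G.IsPropagationClosed k M)
    {v : V} (hv : v ∈ M) (h : (G.neighborSet v \ M).ncard ≤ k) : G.closedNbhd v ⊆ M := by
  refine hM v hv ?_
  rw [closedNbhd, Set.insert_sdiff_of_mem _ hv, ← (Set.toFinite _).cast_ncard_eq]
  exact_mod_cast h

theorem IsPropagationClosed.lt_ncard_sdiff [Finite V] {M : Set V}
    (hM : G.IsPropagationClosed k M) {v u : V} (hv : v ∈ M)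
    (hu : u ∈ G.neighborSet v \ M) : k + 1 ≤ (G.neighborSet v \ M).ncard := by
  by_contra! h
  exact hu.2 (hM.closedNbhd_subset hv (by omega) (Or.inr hu.1))

/-- A boundary vertex `v` of `P^∞(S)` was reached from a vertex all of whose neighbors are
monitored; since that vertex is not adjacent to the unmonitored neighbors of `v`, claw-freeness
makes the latter a clique. -/
theorem isClique_neighborSet_sdiff_monitoredLimit (hclaw : G.IsClawFree) {S : Set V} {v : V}
    (hv : v ∈ G.monitoredLimit k S) :
    G.IsClique (G.neighborSet v \ G.monitoredLimit k S) := by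
  intro a ha b hb hab
  obtain ⟨w, hvw, hw⟩ := exists_closedNbhd_subset_monitoredLimit hv
  have hna : ∀ x, x ∉ G.monitoredLimit k S → ¬ G.Adj w x := fun x hx h => hx (hw (Or.inr h))
  rcases hvw with rfl | hwv
  · exact absurd ha.1 (hna a ha.2)
  · have hwM := hw (self_mem_closedNbhd w)
    rcases isClawFree_iff.mp hclaw v w a b hwv.symm ha.1 hb.1
      (fun h => ha.2 (h ▸ hwM)) (fun h => hb.2 (h ▸ hwM)) hab with h | h | h
    · exact absurd h (hna a ha.2)
    · exact absurd h (hna b hb.2)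
    · exact h

end Closed

/-! ### The upper bound -/

section UpperBound

variable {V : Type*} [Fintype V] {G : SimpleGraph V} [DecidableRel G.Adj] {k l : ℕ}

theorem ncard_neighborSet (hreg : G.IsRegularOfDegree (k + l + 1)) (v : V) :
    (G.neighborSet v).ncard = k + l + 1 := by
  rw [← Nat.card_coe_set_eq, Nat.card_eq_fintype_card, G.card_neighborSet_eq_degree, hreg v]

theorem ncard_closedNbhd (hreg : G.IsRegularOfDegree (k + l + 1)) (v : V) :
    (G.closedNbhd v).ncard = k + l + 2 := by
  rw [closedNbhd, Set.ncard_insert_of_notMem (by simp), ncard_neighborSet hreg]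

/-- In a `(k + l + 1)`-regular graph, a vertex with `l + 1` neighbors in a `k`-closed set
propagates. -/
theorem IsPropagationClosed.closedNbhd_subset_of_lt_ncard {M : Set V}
    (hM : G.IsPropagationClosed k M) (hreg : G.IsRegularOfDegree (k + l + 1)) {v : V} (hv : v ∈ M)
    {T : Set V} (hTv : T ⊆ G.neighborSet v) (hTM : T ⊆ M) (hT : l + 1 ≤ T.ncard) :
    G.closedNbhd v ⊆ M := by
  refine hM.closedNbhd_subset hv ?_
  have h1 : G.neighborSet v \ M ⊆ G.neighborSet v \ T := Set.sdiff_subset_sdiff_right hTM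
  have h2 := Set.ncard_le_ncard h1
  rw [Set.ncard_sdiff hTv, ncard_neighborSet hreg] at h2
  omega

/-- If a `k`-closed set contains `N[p]`, where `p` lies in a clique `K` of at least `k + 1`
neighbors of a vertex `v`, then it contains `N[q]` for every `q ∈ K`. -/
theorem closedNbhd_subset_of_mem_clique (hk : l ≤ k) (hreg : G.IsRegularOfDegree (k + l + 1))
    {M K : Set V} {v p q : V} (hM : G.IsPropagationClosed k M) (hK : G.IsClique K)
    (hKv : K ⊆ G.neighborSet v) (hcard : k + 1 ≤ K.ncard) (hp : p ∈ K) (hq : q ∈ K)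
    (hpM : G.closedNbhd p ⊆ M) : G.closedNbhd q ⊆ M := by
  have hKM : K ⊆ M := fun x hx => hpM (by
    by_cases h : x = p
    · exact Or.inl h
    · exact Or.inr (hK hp hx (Ne.symm h)))
  have hvM : v ∈ M := hpM (Or.inr (hKv hp).symm)
  refine hM.closedNbhd_subset_of_lt_ncard hreg (hKM hq) (T := insert v (K \ {q})) ?_ ?_ ?_
  · rintro x (rfl | ⟨hx, hxq⟩)
    · exact (hKv hq).symm
    · exact hK hq hx (Ne.symm hxq)
  · rintro x (rfl | ⟨hx, -⟩)
    exacts [hvM, hKM hx]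
  · rw [Set.ncard_insert_of_notMem fun h => G.loopless.irrefl v (hKv h.1),
      Set.ncard_sdiff_singleton_of_mem hq]
    omega

/-- A vertex `u` is expansive if choosing `u` alone monitors every vertex at distance at most two
from `u`. -/
def IsExpansive (G : SimpleGraph V) (k : ℕ) (u : V) : Prop :=
  ∀ y ∈ G.closedNbhd u, G.closedNbhd y ⊆ G.monitoredLimit k {u}

/-- An unmonitored vertex `p` that is not expansive has an unmonitored neighbor `y` such that the
cliques of unmonitored neighbors of monitored vertices `v ∼ p` and `v' ∼ y` are always disjoint. -/
theorem exists_adj_disjoint_of_not_isExpansive (hk : l ≤ k)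
    (hreg : G.IsRegularOfDegree (k + l + 1)) (hclaw : G.IsClawFree) {S : Set V} {p : V}
    (hp : p ∉ G.monitoredLimit k S) (hexp : ¬ G.IsExpansive k p) :
    ∃ y, G.Adj p y ∧ y ∉ G.monitoredLimit k S ∧
      ∀ v ∈ G.monitoredLimit k S, G.Adj v p → ∀ v' ∈ G.monitoredLimit k S, G.Adj v' y →
        Disjoint (G.neighborSet v \ G.monitoredLimit k S)
          (G.neighborSet v' \ G.monitoredLimit k S) := by
  set M := G.monitoredLimit k S with hMdef
  set L := G.monitoredLimit k {p} with hLdef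
  have hM : G.IsPropagationClosed k M := isPropagationClosed_monitoredLimit S
  have hL : G.IsPropagationClosed k L := isPropagationClosed_monitoredLimit _
  have hpL : G.closedNbhd p ⊆ L := closedNbhd_subset_monitoredLimit rfl
  have hcl : ∀ v ∈ M, ∀ q q', q ∈ G.neighborSet v \ M → q' ∈ G.neighborSet v \ M →
      G.closedNbhd q ⊆ L → G.closedNbhd q' ⊆ L := fun v hv q q' hq hq' =>
    closedNbhd_subset_of_mem_clique hk hreg hL
      (isClique_neighborSet_sdiff_monitoredLimit hclaw hv) Set.sdiff_subset
      (hM.lt_ncard_sdiff hv hq) hq hq'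
  -- Any clique that touches a vertex with closed neighborhood in `L` lies in `L`.
  have hsub : ∀ v ∈ M, ∀ q, q ∈ G.neighborSet v \ M → G.closedNbhd q ⊆ L →
      G.neighborSet v \ M ⊆ L := fun v hv q hq hqL x hx =>
    hcl v hv q x hq hx hqL (self_mem_closedNbhd x)
  simp only [IsExpansive, not_forall] at hexp
  obtain ⟨y, hy, hyL⟩ := hexp
  have hpy : G.Adj p y := by
    rcases hy with rfl | h
    exacts [absurd hpL hyL, h]
  have hyM : y ∉ M := fun hyM => by
    have hpK : p ∈ G.neighborSet y \ M := ⟨hpy.symm, hp⟩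
    have h1 := hM.lt_ncard_sdiff hyM hpK
    exact hyL (hL.closedNbhd_subset_of_lt_ncard hreg (hpL hy) Set.sdiff_subset
      (hsub y hyM p hpK hpL) (by omega))
  refine ⟨y, hpy, hyM, fun v hv hvp v' hv' hvy' => Set.disjoint_left.mpr fun q hq hq' => hyL ?_⟩
  -- A common vertex `q` would pass `N[p] ⊆ L` on to `N[q] ⊆ L`, and then to `N[y] ⊆ L`.
  exact hcl v' hv' q y hq' ⟨hvy', hyM⟩ (hcl v hv p q ⟨hvp, hp⟩ hq hpL)

/-- If no unmonitored vertex is expansive, some unmonitored vertex can be added to `S` so that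
`k + l + 2` further vertices become monitored. -/
theorem exists_gain (hl : l = 2 ∨ l = 3) (hk : l ≤ k) (hreg : G.IsRegularOfDegree (k + l + 1))
    (hclaw : G.IsClawFree) {S : Set V} (hS : G.monitoredLimit k S ≠ Set.univ)
    (hexp : ∀ u, G.IsExpansive k u → u ∈ G.monitoredLimit k S) :
    ∃ u, u ∉ G.monitoredLimit k S ∧
      (G.monitoredLimit k S).ncard + (k + l + 2) ≤ (G.monitoredLimit k (insert u S)).ncard := by
  set M := G.monitoredLimit k S with hMdef
  have hM : G.IsPropagationClosed k M := isPropagationClosed_monitoredLimit S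
  by_contra! hgain
  have hsub : ∀ u, M ⊆ G.monitoredLimit k (insert u S) := fun u =>
    monitoredLimit_mono (Set.subset_insert u S)
  have hnbr : ∀ u, G.closedNbhd u ⊆ G.monitoredLimit k (insert u S) := fun u =>
    closedNbhd_subset_monitoredLimit (Set.mem_insert u S)
  have hsmall : ∀ u ∉ M, ∀ T ⊆ G.monitoredLimit k (insert u S), Disjoint T M →
      T.ncard ≤ k + l + 1 := by
    intro u hu T hT hTM
    have h1 := hgain u hu
    have h2 := Set.ncard_le_ncard (Set.union_subset hT (hsub u))
    rw [Set.ncard_union_eq hTM] at h2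
    omega
  have hcov : ∀ u ∉ M, ∃ v ∈ M, G.Adj v u := by
    intro u hu
    by_contra! h
    have := hsmall u hu _ (hnbr u) (by
      rw [Set.disjoint_left]
      rintro x (rfl | hx) hxM
      exacts [hu hxM, h x hxM hx.symm])
    rw [ncard_closedNbhd hreg] at this
    omega
  have hcl : ∀ v ∈ M, G.IsClique (G.neighborSet v \ M) := fun v hv =>
    isClique_neighborSet_sdiff_monitoredLimit hclaw hv
  -- `v` is a boundary vertex of `M` with the most unmonitored neighbors, `K` is their set.
  obtain ⟨v, hv, hmax⟩ : ∃ v ∈ M, ∀ v' ∈ M,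
      (G.neighborSet v' \ M).ncard ≤ (G.neighborSet v \ M).ncard := by
    obtain ⟨u, hu⟩ := (Set.ne_univ_iff_exists_notMem M).mp hS
    obtain ⟨v, hv, -⟩ := hcov u hu
    exact Set.exists_max_image M (fun v => (G.neighborSet v \ M).ncard) (Set.toFinite _) ⟨v, hv⟩
  obtain ⟨p, hp⟩ : (G.neighborSet v \ M).Nonempty := by
    obtain ⟨u, hu⟩ := (Set.ne_univ_iff_exists_notMem M).mp hS
    obtain ⟨v', hv', hvu⟩ := hcov u hu
    have h1 := hM.lt_ncard_sdiff hv' ⟨hvu, hu⟩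
    have h2 := hmax v' hv'
    exact Set.nonempty_of_ncard_ne_zero (by omega)
  set K := G.neighborSet v \ M with hKdef
  have hKcard : k + 1 ≤ K.ncard := hM.lt_ncard_sdiff hv hp
  set M' := G.monitoredLimit k (insert p S) with hM'def
  have hM' : G.IsPropagationClosed k M' := isPropagationClosed_monitoredLimit _
  have hKfull : ∀ q ∈ K, G.closedNbhd q ⊆ M' := fun q hq =>
    closedNbhd_subset_of_mem_clique hk hreg hM' (hcl v hv) Set.sdiff_subset hKcard hp hq (hnbr p)
  have hKM' : K ⊆ M' := fun q hq => hKfull q hq (self_mem_closedNbhd q)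
  have hdisj : ∀ T : Set V, Disjoint (T \ M) M := fun T => Set.disjoint_sdiff_left
  -- No second clique, disjoint from `K`, can become monitored: there is no room for both.
  have hroom : ∀ v' ∈ M, ∀ y, y ∉ M → G.Adj v' y → Disjoint K (G.neighborSet v' \ M) →
      ¬ G.neighborSet v' \ M ⊆ M' := by
    intro v' hv' y hy hvy hd hsubM'
    have h1 := hM.lt_ncard_sdiff hv' ⟨hvy, hy⟩
    have h2 := hsmall p hp.2 _ (Set.union_subset hKM' hsubM')
      ((hdisj _).union_left (hdisj _))
    rw [Set.ncard_union_eq hd] at h2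
    omega
  have hy : ∀ q ∈ K, ∃ y, G.Adj q y ∧ y ∉ M ∧ y ∉ K ∧ k + 2 ≤ K.ncard ∧
      (G.neighborSet y ∩ K).ncard ≤ l - 1 := by
    intro q hq
    obtain ⟨y, hqy, hyM, hyd⟩ := exists_adj_disjoint_of_not_isExpansive hk hreg hclaw hq.2
      fun h => hq.2 (hexp q h)
    obtain ⟨v', hv', hvy'⟩ := hcov y hyM
    have hd := hyd v hv hq.1 v' hv' hvy'
    have hyM' : y ∈ M' := hKfull q hq (Or.inr hqy)
    have hv'M' : v' ∈ M' := hsub p hv'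
    have hnot := hroom v' hv' y hyM hvy' hd
    refine ⟨y, hqy, hyM, fun hyK => Set.disjoint_left.mp hd hyK ⟨hvy', hyM⟩, ?_, ?_⟩
    · -- Otherwise `v'` propagates as soon as `y` is monitored.
      by_contra! hlt
      refine hnot fun x hx => hM'.closedNbhd_subset hv'M' ?_ (Or.inr hx.1)
      have h1 : G.neighborSet v' \ M' ⊆ (G.neighborSet v' \ M) \ {y} := fun z hz =>
        ⟨⟨hz.1, fun h => hz.2 (hsub p h)⟩, fun h => hz.2 (h ▸ hyM')⟩
      have h2 := Set.ncard_le_ncard h1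
      rw [Set.ncard_sdiff_singleton_of_mem (show y ∈ G.neighborSet v' \ M from ⟨hvy', hyM⟩)] at h2
      have h3 := hmax v' hv'
      omega
    · -- Otherwise `y` propagates, having `v'` and `l` vertices of `K` as monitored neighbors.
      by_contra! hlt
      have hfull : G.closedNbhd y ⊆ M' := by
        refine hM'.closedNbhd_subset_of_lt_ncard hreg hyM'
          (T := insert v' (G.neighborSet y ∩ K)) ?_ ?_ ?_
        · rintro x (rfl | hx)
          exacts [hvy'.symm, hx.1]
        · rintro x (rfl | hx)
          exacts [hv'M', hKM' hx.2]
        · rw [Set.ncard_insert_of_notMem fun h => h.2.2 hv']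
          omega
      refine hnot fun x hx => hfull ?_
      by_cases hxy : x = y
      · exact Or.inl hxy
      · exact Or.inr (hcl v' hv' ⟨hvy', hyM⟩ hx (Ne.symm hxy))
  choose! f hf using hy
  have hK2 : k + 2 ≤ K.ncard := (hf p hp).2.2.2.1
  -- Count the pairs `(q, f q)`: few vertices outside `K` become monitored, and each of them is
  -- hit at most `l - 1` times.
  have himg : K.ncard ≤ (l - 1) * (f '' K).ncard := by
    classical
    rw [Set.ncard_eq_toFinset_card' K, Set.ncard_eq_toFinset_card' (f '' K), Set.toFinset_image]
    refine Finset.card_le_mul_card_image _ _ fun y hy => ?_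
    obtain ⟨q, hq, rfl⟩ := Finset.mem_image.mp hy
    refine le_trans ?_ (hf q (Set.mem_toFinset.mp hq)).2.2.2.2
    rw [← Set.ncard_coe_finset]
    refine Set.ncard_le_ncard fun x hx => ?_
    simp only [Finset.coe_filter, Set.mem_toFinset, Set.mem_ofPred_eq] at hx
    exact ⟨hx.2 ▸ (hf x hx.1).1.symm, hx.1⟩
  have htot : K.ncard + (f '' K).ncard ≤ k + l + 1 := by
    rw [← Set.ncard_union_eq (Set.disjoint_left.mpr ?_)]
    · refine hsmall p hp.2 _ (Set.union_subset hKM' ?_) ((hdisj _).union_left ?_)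
      · rintro _ ⟨q, hq, rfl⟩
        exact hKfull q hq (Or.inr (hf q hq).1)
      · rw [Set.disjoint_left]
        rintro _ ⟨q, hq, rfl⟩
        exact (hf q hq).2.1
    · rintro x hx ⟨q, hq, rfl⟩
      exact (hf q hq).2.2.1 hx
  rcases hl with rfl | rfl <;> omega

/-- A largest family of expansive vertices with disjoint closed neighborhoods. Every expansive
vertex is monitored as soon as all vertices of this family are chosen. -/
theorem exists_expansive_packing (hreg : G.IsRegularOfDegree (k + l + 1)) :
    ∃ S₀ : Finset V, (k + l + 2) * S₀.card ≤ (G.monitoredLimit k (S₀ : Set V)).ncard ∧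
      ∀ u, G.IsExpansive k u → u ∈ G.monitoredLimit k (S₀ : Set V) := by
  classical
  let F : Set (Finset V) := {S | (∀ s ∈ S, G.IsExpansive k s) ∧
    (S : Set V).PairwiseDisjoint G.closedNbhd}
  obtain ⟨S₀, hS₀, hmax⟩ := Set.exists_max_image F Finset.card (Set.toFinite F)
    ⟨∅, by simp [F]⟩
  refine ⟨S₀, ?_, fun u hu => ?_⟩
  · have h1 : (S₀.biUnion fun s => (G.closedNbhd s).toFinset).card = S₀.card * (k + l + 2) := by
      refine (Finset.card_biUnion ?_).trans (Finset.sum_const_nat fun s _ => ?_)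
      · intro s hs t ht hst
        exact Set.disjoint_toFinset.mpr (hS₀.2 hs ht hst)
      · rw [← Set.ncard_eq_toFinset_card', ncard_closedNbhd hreg]
    rw [mul_comm, ← h1, ← Set.ncard_coe_finset]
    refine Set.ncard_le_ncard fun x hx => ?_
    simp only [Finset.coe_biUnion, Set.mem_iUnion] at hx
    obtain ⟨s, hs, hx⟩ := hx
    exact closedNbhd_subset_monitoredLimit hs (Set.mem_toFinset.mp hx)
  · by_contra hnot
    have huS : u ∉ S₀ := fun h => hnot (subset_monitoredLimit _ h)
    have hF : insert u S₀ ∈ F := by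
      refine ⟨fun s hs => ?_, ?_⟩
      · rcases Finset.mem_insert.mp hs with rfl | hs
        exacts [hu, hS₀.1 s hs]
      · rw [Finset.coe_insert]
        refine hS₀.2.insert fun s hs _ => Set.disjoint_left.mpr fun y hyu hys => hnot ?_
        -- `u` is at distance at most two from the expansive vertex `s`.
        exact monitoredLimit_mono (Set.singleton_subset_iff.mpr hs)
          (hS₀.1 s hs y hys (mem_closedNbhd_comm.mp hyu))
    have := hmax _ hF
    rw [Finset.card_insert_of_notMem huS] at this
    omega

theorem mul_powerDominationNumber_le (hl : l = 2 ∨ l = 3) (hk : l ≤ k)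
    (hreg : G.IsRegularOfDegree (k + l + 1)) (hclaw : G.IsClawFree) :
    (k + l + 2) * G.powerDominationNumber k ≤ Fintype.card V := by
  classical
  obtain ⟨S₀, hS₀, hexp⟩ := exists_expansive_packing (k := k) hreg
  let F : Set (Finset V) :=
    {S | S₀ ⊆ S ∧ (k + l + 2) * S.card ≤ (G.monitoredLimit k (S : Set V)).ncard}
  obtain ⟨S, hS, hmax⟩ := Set.exists_max_image F Finset.card (Set.toFinite F)
    ⟨S₀, subset_rfl, hS₀⟩
  by_cases hdom : G.monitoredLimit k (S : Set V) = Set.univ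
  · have h1 := hS.2
    rw [hdom, Set.ncard_univ, Nat.card_eq_fintype_card] at h1
    exact (Nat.mul_le_mul_left _ (powerDominationNumber_le hdom)).trans h1
  · obtain ⟨u, hu, hgain⟩ := exists_gain hl hk hreg hclaw hdom fun u hu =>
      monitoredLimit_mono (Finset.coe_subset.mpr hS.1) (hexp u hu)
    have huS : u ∉ S := fun h => hu (subset_monitoredLimit _ h)
    have hF : insert u S ∈ F := by
      refine ⟨hS.1.trans (Finset.subset_insert u S), ?_⟩
      have h1 := hS.2
      rw [Finset.card_insert_of_notMem huS, Finset.coe_insert, mul_add, mul_one]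
      omega
    have := hmax _ hF
    rw [Finset.card_insert_of_notMem huS] at this
    omega

end UpperBound

/-! ### The cyclic chain -/

section CyclicChain

variable {k l t : ℕ}

/-- The cyclic successor on the `t` copies. -/
noncomputable def nextCopy (t : ℕ) : Equiv.Perm (Fin t) :=
  Equiv.ofBijective (fun i => ⟨((i : ℕ) + 1) % t, Nat.mod_lt _ i.pos⟩) <| by
    refine Finite.injective_iff_bijective.mp fun i j hij => Fin.ext ?_
    have h : (i : ℕ) + 1 ≡ j + 1 [MOD t] := congrArg Fin.val hij
    exact Nat.ModEq.eq_of_lt_of_lt h.add_right_cancel' i.isLt j.isLt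

theorem coe_nextCopy (i : Fin t) : (nextCopy t i : ℕ) = ((i : ℕ) + 1) % t := rfl

theorem graphA_adj {a b : Fin (k + l + 2)} : (graphA k l).Adj a b ↔
    a ≠ b ∧ ¬ ((a : ℕ) = 0 ∧ 1 ≤ (b : ℕ) ∧ (b : ℕ) ≤ l) ∧
      ¬ ((b : ℕ) = 0 ∧ 1 ≤ (a : ℕ) ∧ (a : ℕ) ≤ l) := by
  rw [graphA, deleteEdges_adj, top_adj, Set.mem_ofPred_eq]
  refine and_congr_right fun _ => ?_
  rw [← not_or, not_iff_not]
  constructor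
  · rintro ⟨c, h1, h2, h⟩
    rcases Sym2.eq_iff.mp h with ⟨rfl, rfl⟩ | ⟨rfl, rfl⟩
    exacts [Or.inl ⟨rfl, h1, h2⟩, Or.inr ⟨rfl, h1, h2⟩]
  · rintro (⟨h0, h1, h2⟩ | ⟨h0, h1, h2⟩)
    · exact ⟨b, h1, h2, by rw [show a = 0 from Fin.ext h0]⟩
    · exact ⟨a, h1, h2, by rw [show b = 0 from Fin.ext h0, Sym2.eq_swap]⟩

theorem chainLink_iff {p q : Fin t × Fin (k + l + 2)} : chainLink k l t p q ↔
    q.1 = nextCopy t p.1 ∧ (p.2 : ℕ) = 0 ∧ 1 ≤ (q.2 : ℕ) ∧ (q.2 : ℕ) ≤ l := by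
  rw [chainLink, Fin.ext_iff, coe_nextCopy]

/-- The copy that contains the vertex labelled `b` of the closed neighborhood of `p` in `C_{k,t}`;
see `cyclicChain_adj`. -/
noncomputable def nbrCopy (k l t : ℕ) (p : Fin t × Fin (k + l + 2)) (b : Fin (k + l + 2)) :
    Fin t :=
  if (p.2 : ℕ) = 0 ∧ 1 ≤ (b : ℕ) ∧ (b : ℕ) ≤ l then nextCopy t p.1
  else if (b : ℕ) = 0 ∧ 1 ≤ (p.2 : ℕ) ∧ (p.2 : ℕ) ≤ l then (nextCopy t).symm p.1
  else p.1

/-- Each closed neighborhood of `C_{k,t}` has exactly one vertex for each of the `k + l + 2` labels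
in `A_l`. -/
theorem cyclicChain_adj {p q : Fin t × Fin (k + l + 2)} : (cyclicChain k l t).Adj p q ↔
    p ≠ q ∧ q.1 = nbrCopy k l t p q.2 := by
  change (_ ∧ _) ∨ _ ∨ _ ↔ _
  rw [graphA_adj, chainLink_iff, chainLink_iff, nbrCopy, Ne, Ne, Prod.ext_iff,
    Fin.ext_iff (a := p.2)]
  split_ifs with h1 h2
  · have h : (p.2 : ℕ) ≠ q.2 := by omega
    have h2 : (q.2 : ℕ) ≠ 0 := by omega
    simp [h1, h2]
    omega
  · have h : (p.2 : ℕ) ≠ q.2 := by omega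
    have h3 : (p.2 : ℕ) ≠ 0 := by omega
    rw [Equiv.eq_symm_apply, eq_comm (a := p.1) (b := nextCopy t q.1)]
    simp [h2, h3]
  · constructor
    · rintro (⟨h, hne, -⟩ | h | h)
      exacts [⟨fun h' => hne h'.2, h.symm⟩, absurd h.2 h1, absurd h.2 h2]
    · rintro ⟨hne, h⟩
      exact Or.inl ⟨h.symm, fun h' => hne ⟨h.symm, h'⟩, h1, h2⟩

theorem mem_closedNbhd_cyclicChain {p q : Fin t × Fin (k + l + 2)} :
    q ∈ (cyclicChain k l t).closedNbhd p ↔ q.1 = nbrCopy k l t p q.2 := by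
  rw [mem_closedNbhd_iff, cyclicChain_adj]
  by_cases h : q = p
  · subst h
    simp only [true_or, true_iff, nbrCopy]
    rw [if_neg (by omega), if_neg (by omega)]
  · simp [h, Ne.symm h]

theorem isRegularOfDegree_cyclicChain :
    (cyclicChain k l t).IsRegularOfDegree (k + l + 1) := by
  intro p
  have h1 : (cyclicChain k l t).closedNbhd p =
      Set.range fun b => (nbrCopy k l t p b, b) := by
    ext q
    rw [mem_closedNbhd_cyclicChain]
    constructor
    · exact fun h => ⟨q.2, Prod.ext h.symm rfl⟩
    · rintro ⟨b, rfl⟩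
      rfl
  have h2 : ((cyclicChain k l t).closedNbhd p).ncard = k + l + 2 := by
    rw [h1, ← Set.image_univ, Set.ncard_image_of_injective _ fun a b h => (Prod.ext_iff.mp h).2,
      Set.ncard_univ, Nat.card_eq_fintype_card, Fintype.card_fin]
  rw [closedNbhd, Set.ncard_insert_of_notMem (by simp), ← Nat.card_coe_set_eq,
    Nat.card_eq_fintype_card, card_neighborSet_eq_degree] at h2
  omega

theorem isClawFree_cyclicChain : (cyclicChain k l t).IsClawFree := by
  -- The neighbors of `c` split into two cliques. If `c` is a vertex `z`, they are the neighbors in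
  -- its own and in the next copy; otherwise they are the at most one vertex `z` and the others.
  have key : ∀ c p q : Fin t × Fin (k + l + 2), (cyclicChain k l t).Adj c p →
      (cyclicChain k l t).Adj c q → p ≠ q →
      ((if (c.2 : ℕ) = 0 then l < (p.2 : ℕ) else (p.2 : ℕ) = 0) ↔
        (if (c.2 : ℕ) = 0 then l < (q.2 : ℕ) else (q.2 : ℕ) = 0)) →
      (cyclicChain k l t).Adj p q := by
    intro c p q hp hq hpq h
    rw [cyclicChain_adj] at hp hq ⊢
    refine ⟨hpq, ?_⟩
    obtain ⟨hcp, hp⟩ := hp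
    obtain ⟨hcq, hq⟩ := hq
    rw [Ne, Prod.ext_iff, Fin.ext_iff (a := Prod.snd _)] at hcp hcq hpq
    unfold nbrCopy at *
    grind
  refine isClawFree_iff.mpr fun c x y z hx hy hz hxy hxz hyz => ?_
  have h1 := key c x y hx hy hxy
  have h2 := key c x z hx hz hxz
  have h3 := key c y z hy hz hyz
  tauto

theorem connected_cyclicChain (hl : 1 ≤ l) (ht : 1 ≤ t) : (cyclicChain k l t).Connected := by
  let hub : Fin t → Fin t × Fin (k + l + 2) := fun i => (i, Fin.last _)
  have hcopy : ∀ p, (cyclicChain k l t).Reachable (hub p.1) p := by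
    intro p
    by_cases h : hub p.1 = p
    · rw [h]
    · refine Adj.reachable (cyclicChain_adj.mpr ⟨h, ?_⟩)
      simp only [hub, nbrCopy, Fin.val_last]
      rw [if_neg (by omega), if_neg (by omega)]
  have hnext : ∀ i, (cyclicChain k l t).Reachable (hub i) (hub (nextCopy t i)) := by
    intro i
    refine (hcopy (i, 0)).trans (Reachable.trans (Adj.reachable ?_)
      (hcopy (nextCopy t i, ⟨1, by omega⟩)).symm)
    exact Or.inr (Or.inl ⟨rfl, rfl, le_rfl, hl⟩)
  have hhub : ∀ n (hn : n < t), (cyclicChain k l t).Reachable (hub ⟨0, ht⟩) (hub ⟨n, hn⟩) := by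
    intro n
    induction n with
    | zero => exact fun _ => Reachable.refl _
    | succ n ih =>
      intro hn
      have h : nextCopy t ⟨n, by omega⟩ = ⟨n + 1, hn⟩ := Fin.ext (Nat.mod_eq_of_lt hn)
      exact (ih (by omega)).trans (h ▸ hnext ⟨n, by omega⟩)
  exact (connected_iff_exists_forall_reachable _).mpr
    ⟨hub ⟨0, ht⟩, fun p => (hhub p.1 p.1.isLt).trans (hcopy p)⟩

/-- A power dominating set of `C_{k,t}` meets every copy: otherwise the `k + 1` vertices of that
copy that lost no edge are never monitored, as each vertex outside is adjacent to all or none of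
them. -/
theorem exists_mem_of_isPowerDominating {S : Set (Fin t × Fin (k + l + 2))}
    (hS : (cyclicChain k l t).IsPowerDominating k S) (i : Fin t) : ∃ b, (i, b) ∈ S := by
  by_contra! hno
  set T : Set (Fin t × Fin (k + l + 2)) := {q | ¬ (q.1 = i ∧ l < (q.2 : ℕ))} with hT
  have hin : ∀ v q, q ∈ (cyclicChain k l t).closedNbhd v → q ∉ T → v.1 = i := by
    intro v q hq hqT
    rw [mem_closedNbhd_cyclicChain, nbrCopy] at hq
    simp only [hT, Set.mem_ofPred_eq, not_not] at hqT
    rw [if_neg (by omega), if_neg (by omega)] at hq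
    exact hq ▸ hqT.1
  have hclosed : (cyclicChain k l t).IsPropagationClosed k T := by
    intro v hv hle q hq
    by_contra hqT
    have hvi := hin v q hq hqT
    have hvl : (v.2 : ℕ) ≤ l := by
      by_contra! h
      exact hv ⟨hvi, h⟩
    have hsub : Set.range (fun j : Fin (k + 1) => (i, (⟨l + 1 + j, by omega⟩ : Fin (k + l + 2)))) ⊆
        (cyclicChain k l t).closedNbhd v \ T := by
      rintro _ ⟨j, rfl⟩
      refine ⟨mem_closedNbhd_cyclicChain.mpr ?_, fun h => h ⟨rfl, ?_⟩⟩
      · simp only [nbrCopy]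
        rw [if_neg (by omega), if_neg (by omega), hvi]
      · simp only
        omega
    have h1 := (Set.encard_le_encard hsub).trans hle
    rw [← Set.image_univ, Function.Injective.encard_image, Set.encard_univ] at h1
    · simp only [ENat.card_eq_coe_fintype_card, Fintype.card_fin] at h1
      norm_cast at h1
      omega
    · intro a b hab
      simp only [Prod.mk.injEq, true_and, Fin.mk.injEq] at hab
      exact Fin.ext (by omega)
  have hsub : (cyclicChain k l t).monitoredLimit k S ⊆ T := by
    refine monitoredLimit_subset hclosed fun v hv q hq => ?_
    by_contra hqT
    refine hno v.2 ?_
    rwa [← hin v q hq hqT]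
  rw [hS] at hsub
  exact hsub (Set.mem_univ (i, Fin.last _)) ⟨rfl, by simp only [Fin.val_last]; omega⟩

theorem le_powerDominationNumber_cyclicChain :
    t ≤ (cyclicChain k l t).powerDominationNumber k := by
  refine le_csInf ⟨_, Finset.univ, ?_, rfl⟩ ?_
  · rw [Finset.coe_univ]
    exact isPowerDominating_univ _ k
  · rintro _ ⟨S, hS, rfl⟩
    have h : S.image Prod.fst = Finset.univ := by
      ext i
      obtain ⟨b, hb⟩ := exists_mem_of_isPowerDominating hS i
      simp only [Finset.mem_univ, iff_true]
      exact Finset.mem_image.mpr ⟨_, hb, rfl⟩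
    calc t = (S.image Prod.fst).card := by rw [h, Finset.card_univ, Fintype.card_fin]
      _ ≤ S.card := Finset.card_image_le

end CyclicChain

end SimpleGraph

theorem theorem1 (l k : ℕ) (hl : l = 2 ∨ l = 3) (hk : l ≤ k) :
    (∀ (V : Type*) [Fintype V] (G : SimpleGraph V) [DecidableRel G.Adj],
      G.Connected → G.IsClawFree → G.IsRegularOfDegree (k + l + 1) →
        (G.powerDominationNumber k : ℚ) ≤ (Fintype.card V : ℚ) / ((k : ℚ) + l + 2)) ∧
    (∀ t : ℕ, 1 ≤ t →
      (SimpleGraph.cyclicChain k l t).Connected ∧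
      (SimpleGraph.cyclicChain k l t).IsClawFree ∧
      (SimpleGraph.cyclicChain k l t).IsRegularOfDegree (k + l + 1) ∧
      Fintype.card (Fin t × Fin (k + l + 2)) = t * (k + l + 2) ∧
      ((SimpleGraph.cyclicChain k l t).powerDominationNumber k : ℚ) =
        (Fintype.card (Fin t × Fin (k + l + 2)) : ℚ) / ((k : ℚ) + l + 2)) := by
  refine ⟨fun V _ G _ _ hclaw hreg => ?_, fun t ht => ?_⟩
  · have h := SimpleGraph.mul_powerDominationNumber_le hl hk hreg hclaw
    rw [le_div_iff₀ (by positivity), mul_comm]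
    exact_mod_cast h
  · have hcard : Fintype.card (Fin t × Fin (k + l + 2)) = t * (k + l + 2) := by simp
    have hle := SimpleGraph.mul_powerDominationNumber_le hl hk
      (SimpleGraph.isRegularOfDegree_cyclicChain (t := t)) SimpleGraph.isClawFree_cyclicChain
    have hγ : (SimpleGraph.cyclicChain k l t).powerDominationNumber k = t := by
      refine le_antisymm ?_ SimpleGraph.le_powerDominationNumber_cyclicChain
      rw [hcard, mul_comm t] at hle
      exact Nat.le_of_mul_le_mul_left hle (by omega)
    refine ⟨SimpleGraph.connected_cyclicChain (by omega) ht, SimpleGraph.isClawFree_cyclicChain,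
      SimpleGraph.isRegularOfDegree_cyclicChain, hcard, ?_⟩
    rw [hγ, hcard, eq_div_iff (by positivity)]
    push_cast
    ring
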